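/- Let $M$ be a smooth $n$-dimensional manifold, let $F$ be a Finsler metric on $M$ (smooth and positive on $TM_0=TM\setminus\{0\}$, positively $1$-homogeneous, with positive definite fundamental tensor $g_{ij}=\frac12[F^2]_{y^iy^j}$), and let $\mu$ be a measure on $M$ with smooth positive density, $d\mu=\rho(x)\,dx$ in local coordinates. Let $G^i=\frac14 g^{ij}\{[F^2]_{y^jx^k}y^k-[F^2]_{x^j}\}$ be the spray coefficients, $N^i_j=\partial G^i/\partial y^j$, $\frac{\delta}{\delta x^i}=\frac{\partial}{\partial x^i}-N^j_i\frac{\partial}{\partial y^j}$, and let $\Gamma^i_{jk}=\frac12 g^{il}\big\{\frac{\delta g_{jl}}{\delta x^k}+\frac{\delta g_{lk}}{\delta x^j}-\frac{\delta g_{jk}}{\delta x^l}\big\}$ be the coefficients of the Chern connection, with Chern Riemannian curvature $$R_j{}^i{}_{kl}=\frac{\delta\Gamma^i_{jl}}{\delta x^k}-\frac{\delta\Gamma^i_{jk}}{\delta x^l}+\Gamma^i_{km}\Gamma^m_{jl}-\Gamma^i_{lm}\Gamma^m_{jk}.$$ Let $\tau=\log\frac{\sqrt{\det(g_{ij})}}{\rho}$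 be the distortion, let $\tau_{|i}=\frac{\delta\tau}{\delta x^i}$ and $\tau_{|i|j}=\frac{\delta\tau_{|i}}{\delta x^j}-\Gamma^k_{ij}\tau_{|k}$ be its horizontal Chern covariant derivatives, let $S$ be the S-curvature (the derivative of $\tau(\gamma,\dot\gamma)$ along geodesics $\ddot\gamma^i+2G^i(\gamma,\dot\gamma)=0$), and let $\dot S$ be the derivative of $S$ along geodesics. For $(x,y)\in TM_0$ put $$Ric^\infty(x,y)=y^jR_j{}^k{}_{kl}y^l+\dot S(x,y),\qquad Ric^\infty_y(V,W)=\big(R_i{}^k{}_{kj}+\tau_{|i|j}\big)V^iW^j\quad (V,W\in T_xM).$$ For a function $\sigma$ on $M$ consider the following equations, each required at every $x\in M$, for every $0\neq y\in T_xM$ and all $V,W\in T_xM$: (G) $Ric^\infty(x,y)=\sigma(x)F^2(x,y)$; (A) $Ric^\infty_y(y,V)=\sigma(x)g_y(y,V)$; (S) $\frac12\big[Ric^\infty_y(y,V)+Ric^\infty_y(V,y)\big]=\sigma(x)g_y(y,V)$; (AE) $Ric^\infty_y(V,W)=\sigma(x)g_y(V,W)$. The space $(M,F,\mu)$ is called a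 gradient almost Ricci soliton, respectively an asymmetric, a symmetric, or an asymmetric essential gradient almost Ricci soliton, if there is a function $\sigma:M\to\mathbb R$ for which (G), respectively (A), (S), (AE), holds. **Proposition.** Suppose that $F$ is a Landsberg metric, i.e. its Landsberg curvature $L^i_{jk}=[G^i]_{y^jy^k}-\Gamma^i_{jk}$ vanishes on $TM_0$. Then: 1. $(M,F,\mu)$ is an asymmetric essential gradient almost Ricci soliton if and only if it is an asymmetric gradient almost Ricci soliton. 2. $(M,F,\mu)$ is a gradient almost Ricci soliton if and only if it is a symmetric gradient almost Ricci soliton. In both cases the equations are equivalent with the same factor: for every function $\sigma:M\to\mathbb R$, (AE) holds if and only if (A) holds, and (G) holds if and only if (S) holds. -/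

import Mathlib

open scoped Manifold ContDiff

noncomputable section

namespace Finsler

/-! ### Local calculus on a coordinate patch

A point `p = (u, y)` of `ℝⁿ × ℝⁿ` stands for the tangent vector `y = yⁱ ∂/∂xⁱ` at the point with
coordinates `u`.  In this part `F` is the coordinate expression of a Finsler metric, and `ρ` the
coordinate density of a measure. -/

/-- The coordinate space `ℝⁿ`. -/
abbrev E (n : ℕ) : Type := EuclideanSpace ℝ (Fin n)

variable {n : ℕ}

/-- `∂f/∂xⁱ` for a function `f(x, y)`. -/
def pdx (i : Fin n) (f : E n × E n → ℝ) (p : E n × E n) : ℝ :=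
  fderiv ℝ f p (EuclideanSpace.single i 1, 0)

/-- `∂f/∂yⁱ` for a function `f(x, y)`. -/
def pdy (i : Fin n) (f : E n × E n → ℝ) (p : E n × E n) : ℝ :=
  fderiv ℝ f p (0, EuclideanSpace.single i 1)

/-- The fundamental tensor matrix `g_{ij} = ½ [F²]_{yⁱ yʲ}`. -/
def fundMatrix (F : E n × E n → ℝ) (p : E n × E n) : Matrix (Fin n) (Fin n) ℝ :=
  Matrix.of fun i j => (1 / 2) * pdy i (pdy j fun q => F q ^ 2) p

/-- `g_{ij}` as a function of `(x, y)`. -/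
def g (F : E n × E n → ℝ) (i j : Fin n) (p : E n × E n) : ℝ := fundMatrix F p i j

/-- The inverse matrix `g^{ij}`. -/
def gInv (F : E n × E n → ℝ) (i j : Fin n) (p : E n × E n) : ℝ := (fundMatrix F p)⁻¹ i j

/-- Spray coefficients `Gⁱ = ¼ g^{ij} ([F²]_{yʲ xᵏ} yᵏ - [F²]_{xʲ})`. -/
def spray (F : E n × E n → ℝ) (i : Fin n) (p : E n × E n) : ℝ :=
  (1 / 4) * ∑ j, gInv F i j p *
    ((∑ k, pdx k (pdy j fun q => F q ^ 2) p * p.2 k) - pdx j (fun q => F q ^ 2) p)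

/-- Nonlinear connection coefficients `Nⁱⱼ = ∂Gⁱ/∂yʲ`. -/
def nonlin (F : E n × E n → ℝ) (i j : Fin n) (p : E n × E n) : ℝ := pdy j (spray F i) p

/-- Horizontal derivative `δf/δxⁱ = ∂f/∂xⁱ - Nʲᵢ ∂f/∂yʲ`. -/
def hd (F : E n × E n → ℝ) (i : Fin n) (f : E n × E n → ℝ) (p : E n × E n) : ℝ :=
  pdx i f p - ∑ j, nonlin F j i p * pdy j f p

/-- Chern connection coefficients
`Γⁱⱼₖ = ½ g^{il} (δg_{jl}/δxᵏ + δg_{lk}/δxʲ - δg_{jk}/δxˡ)`. -/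
def chern (F : E n × E n → ℝ) (i j k : Fin n) (p : E n × E n) : ℝ :=
  (1 / 2) * ∑ l, gInv F i l p * (hd F k (g F j l) p + hd F j (g F l k) p - hd F l (g F j k) p)

/-- Chern Riemannian curvature `Rⱼⁱₖₗ`; the arguments are given in the order `j i k l`. -/
def chernRiem (F : E n × E n → ℝ) (j i k l : Fin n) (p : E n × E n) : ℝ :=
  hd F k (chern F i j l) p - hd F l (chern F i j k) p
    + ∑ m, (chern F i k m p * chern F m j l p - chern F i l m p * chern F m j k p)

/-- Landsberg curvature `Lⁱⱼₖ = [Gⁱ]_{yʲ yᵏ} - Γⁱⱼₖ`. -/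
def landsberg (F : E n × E n → ℝ) (i j k : Fin n) (p : E n × E n) : ℝ :=
  pdy k (pdy j (spray F i)) p - chern F i j k p

/-- Ricci curvature `Ric = yʲ Rⱼᵏₖₗ yˡ`. -/
def ricci (F : E n × E n → ℝ) (p : E n × E n) : ℝ :=
  ∑ j, ∑ k, ∑ l, p.2 j * chernRiem F j k k l p * p.2 l

/-- Distortion `τ = log (√det(g_{ij}) / ρ)`. -/
def distortion (F : E n × E n → ℝ) (ρ : E n → ℝ) (p : E n × E n) : ℝ :=
  Real.log (Real.sqrt (fundMatrix F p).det / ρ p.1)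

/-- Second horizontal covariant derivative `f_{|i|j}` of a scalar `f(x, y)` with respect to the
Chern connection: `f_{|i} = δf/δxⁱ` and `f_{|i|j} = δ(f_{|i})/δxʲ - Γᵏᵢⱼ f_{|k}`. -/
def hd2 (F f : E n × E n → ℝ) (i j : Fin n) (p : E n × E n) : ℝ :=
  hd F j (hd F i f) p - ∑ k, chern F k i j p * hd F k f p

/-- Components `Rᵢᵏₖⱼ + τ_{|i|j}` of the weighted Ricci tensor `Ric^∞_y`. -/
def wRic (F : E n × E n → ℝ) (ρ : E n → ℝ) (i j : Fin n) (p : E n × E n) : ℝ :=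
  (∑ k, chernRiem F i k k j p) + hd2 F (distortion F ρ) i j p

/-- `γ` is, near time `0`, a geodesic `γ̈ⁱ + 2 Gⁱ(γ, γ̇) = 0`, with `(γ(0), γ̇(0)) = p`. -/
def IsGeodesicFrom (F : E n × E n → ℝ) (γ : ℝ → E n) (p : E n × E n) : Prop :=
  γ 0 = p.1 ∧ deriv γ 0 = p.2 ∧
    ∀ᶠ t in nhds (0 : ℝ), DifferentiableAt ℝ γ t ∧
      HasDerivAt (deriv γ) (WithLp.toLp 2 fun i => -2 * spray F i (γ t, deriv γ t)) t

open Classical in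
/-- Derivative of `f(x, y)` along the geodesic with initial data `p`: `d/dt f(γ(t), γ̇(t))` at
`t = 0`.  (A geodesic exists for all initial data with `y ≠ 0`; for smooth `f` the result does not
depend on the germ of `γ` chosen, because `γ̈(0)` is determined by `p`.) -/
def geodesicDeriv (F f : E n × E n → ℝ) (p : E n × E n) : ℝ :=
  if h : ∃ γ : ℝ → E n, IsGeodesicFrom F γ p then
    deriv (fun t => f (h.choose t, deriv h.choose t)) 0
  else 0

/-- S-curvature: the derivative of the distortion along geodesics. -/
def sCurv (F : E n × E n → ℝ) (ρ : E n → ℝ) (p : E n × E n) : ℝ :=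
  geodesicDeriv F (distortion F ρ) p

/-- Weighted Ricci curvature `Ric^∞(x, y) = Ric(x, y) + Ṡ(x, y)`, where `Ṡ` is the derivative of
the S-curvature along geodesics. -/
def ricInfScalar (F : E n × E n → ℝ) (ρ : E n → ℝ) (p : E n × E n) : ℝ :=
  ricci F p + geodesicDeriv F (sCurv F ρ) p

/-! ### Finsler metric measure spaces -/

section Manifold

variable (n) (M : Type*) [TopologicalSpace M] [ChartedSpace (E n) M]

/-- The smooth charts (local coordinate systems) of `M`. -/
abbrev smoothCharts : Set (OpenPartialHomeomorph M (E n)) :=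
  IsManifold.maximalAtlas (𝓡 n) ∞ M

variable {n M}

/-- Coordinate expression of a function on `TM` in the natural coordinates of the chart `φ`:
`(u, y) ↦ f (φ⁻¹(u), yⁱ ∂/∂xⁱ)`. -/
def localExpr (φ : OpenPartialHomeomorph M (E n)) (f : TangentBundle (𝓡 n) M → ℝ)
    (p : E n × E n) : ℝ :=
  f ⟨φ.symm p.1, mfderiv (𝓡 n) (𝓡 n) φ.symm p.1 p.2⟩

/-- The components `(Vⁱ)` of a tangent vector `V = Vⁱ ∂/∂xⁱ` at `x` in the chart `φ`. -/
def comps (φ : OpenPartialHomeomorph M (E n)) (x : M) (V : TangentSpace (𝓡 n) x) : E n :=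
  mfderiv (𝓡 n) (𝓡 n) φ x V

variable (n M) [IsManifold (𝓡 n) ∞ M]

/-- A Finsler metric on `M`. -/
structure Metric where
  /-- The function `F : TM → [0, ∞)`. -/
  toFun : TangentBundle (𝓡 n) M → ℝ
  nonneg : ∀ v, 0 ≤ toFun v
  smooth : ContMDiffOn (𝓡 n).tangent 𝓘(ℝ, ℝ) ∞ toFun {v | v.2 ≠ 0}
  pos : ∀ (x : M) (y : TangentSpace (𝓡 n) x), y ≠ 0 → 0 < toFun ⟨x, y⟩
  homog : ∀ (x : M) (y : TangentSpace (𝓡 n) x) (k : ℝ), 0 < k →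
    toFun ⟨x, k • y⟩ = k * toFun ⟨x, y⟩
  strongConvex : ∀ φ ∈ smoothCharts n M, ∀ x ∈ φ.source, ∀ y : TangentSpace (𝓡 n) x, y ≠ 0 →
    (fundMatrix (localExpr φ toFun) (φ x, comps φ x y)).PosDef

/-- A measure on `M` given in each chart by a smooth positive density, `dμ = ρ(x) dx`. -/
structure SmoothMeasure [MeasurableSpace M] where
  /-- The measure. -/
  toMeasure : MeasureTheory.Measure M
  /-- Its density with respect to the Lebesgue measure of the coordinates. -/
  density : OpenPartialHomeomorph M (E n) → E n → ℝ
  density_smooth : ∀ φ ∈ smoothCharts n M, ContDiffOn ℝ ∞ (density φ) φ.target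
  density_pos : ∀ φ ∈ smoothCharts n M, ∀ u ∈ φ.target, 0 < density φ u
  measure_image : ∀ φ ∈ smoothCharts n M, ∀ A ⊆ φ.target, MeasurableSet A →
    toMeasure (φ.symm '' A) = ∫⁻ u in A, ENNReal.ofReal (density φ u)

variable {n M}

/-- `g_y(V, W)`, computed in the chart `φ`. -/
def gForm (F : Metric n M) (φ : OpenPartialHomeomorph M (E n)) (x : M)
    (y V W : TangentSpace (𝓡 n) x) : ℝ :=
  ∑ i, ∑ j, g (localExpr φ F.toFun) i j (φ x, comps φ x y) * comps φ x V i * comps φ x W j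

/-- `F` is a Landsberg metric: its Landsberg curvature vanishes on `TM₀`. -/
def IsLandsberg (F : Metric n M) : Prop :=
  ∀ φ ∈ smoothCharts n M, ∀ x ∈ φ.source, ∀ y : TangentSpace (𝓡 n) x, y ≠ 0 →
    ∀ i j k, landsberg (localExpr φ F.toFun) i j k (φ x, comps φ x y) = 0

variable [MeasurableSpace M]

/-- `Ric^∞(x, y)`, computed in the chart `φ`. -/
def ricInf (F : Metric n M) (μ : SmoothMeasure n M) (φ : OpenPartialHomeomorph M (E n)) (x : M)
    (y : TangentSpace (𝓡 n) x) : ℝ :=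
  ricInfScalar (localExpr φ F.toFun) (μ.density φ) (φ x, comps φ x y)

/-- `Ric^∞_y(V, W) = (Rᵢᵏₖⱼ + τ_{|i|j}) Vⁱ Wʲ`, computed in the chart `φ`. -/
def ricInfForm (F : Metric n M) (μ : SmoothMeasure n M) (φ : OpenPartialHomeomorph M (E n)) (x : M)
    (y V W : TangentSpace (𝓡 n) x) : ℝ :=
  ∑ i, ∑ j, wRic (localExpr φ F.toFun) (μ.density φ) i j (φ x, comps φ x y)
    * comps φ x V i * comps φ x W j

/-- `Ric^∞(x, y) = σ(x) F²(x, y)` on `TM₀`. -/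
def GradientEq (F : Metric n M) (μ : SmoothMeasure n M) (σ : M → ℝ) : Prop :=
  ∀ φ ∈ smoothCharts n M, ∀ x ∈ φ.source, ∀ y : TangentSpace (𝓡 n) x, y ≠ 0 →
    ricInf F μ φ x y = σ x * F.toFun ⟨x, y⟩ ^ 2

/-- `Ric^∞_y(y, V) = σ(x) g_y(y, V)` for all `V`. -/
def AsymmetricEq (F : Metric n M) (μ : SmoothMeasure n M) (σ : M → ℝ) : Prop :=
  ∀ φ ∈ smoothCharts n M, ∀ x ∈ φ.source, ∀ y : TangentSpace (𝓡 n) x, y ≠ 0 →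
    ∀ V : TangentSpace (𝓡 n) x, ricInfForm F μ φ x y y V = σ x * gForm F φ x y y V

/-- `½ (Ric^∞_y(y, V) + Ric^∞_y(V, y)) = σ(x) g_y(y, V)` for all `V`. -/
def SymmetricEq (F : Metric n M) (μ : SmoothMeasure n M) (σ : M → ℝ) : Prop :=
  ∀ φ ∈ smoothCharts n M, ∀ x ∈ φ.source, ∀ y : TangentSpace (𝓡 n) x, y ≠ 0 →
    ∀ V : TangentSpace (𝓡 n) x,
      (1 / 2) * (ricInfForm F μ φ x y y V + ricInfForm F μ φ x y V y) = σ x * gForm F φ x y y V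

/-- `Ric^∞_y(V, W) = σ(x) g_y(V, W)` for all `V`, `W`. -/
def AsymmetricEssentialEq (F : Metric n M) (μ : SmoothMeasure n M) (σ : M → ℝ) : Prop :=
  ∀ φ ∈ smoothCharts n M, ∀ x ∈ φ.source, ∀ y : TangentSpace (𝓡 n) x, y ≠ 0 →
    ∀ V W : TangentSpace (𝓡 n) x, ricInfForm F μ φ x y V W = σ x * gForm F φ x y V W

/-- Gradient almost Ricci soliton. -/
def IsGradientAlmostRicciSoliton (F : Metric n M) (μ : SmoothMeasure n M) : Prop :=
  ∃ σ : M → ℝ, GradientEq F μ σ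

/-- Asymmetric gradient almost Ricci soliton. -/
def IsAsymmetricGradientAlmostRicciSoliton (F : Metric n M) (μ : SmoothMeasure n M) : Prop :=
  ∃ σ : M → ℝ, AsymmetricEq F μ σ

/-- Symmetric gradient almost Ricci soliton. -/
def IsSymmetricGradientAlmostRicciSoliton (F : Metric n M) (μ : SmoothMeasure n M) : Prop :=
  ∃ σ : M → ℝ, SymmetricEq F μ σ

/-- Asymmetric essential gradient almost Ricci soliton. -/
def IsAsymmetricEssentialGradientAlmostRicciSoliton (F : Metric n M) (μ : SmoothMeasure n M) :
    Prop :=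
  ∃ σ : M → ℝ, AsymmetricEssentialEq F μ σ

end Manifold

end Finsler

end

/-!
For a Landsberg metric the Chern coefficients are vertical derivatives of the spray,
`Γⁱⱼₖ = [Gⁱ]_{yʲyᵏ} = ∂Nⁱⱼ/∂yᵏ`, and everything rests on one consequence: the weighted Ricci tensor
`W_{ij} = Rᵢᵏₖⱼ + τ_{|i|j}` is the vertical derivative of its contraction `A_j = yⁱ W_{ij}`, i.e.
`∂A_j/∂yˡ = W_{lj}` (`IsLocalMetric.sum_mul_wRic`, `IsLocalMetric.pdy_ricCovector`).

For the curvature part, `yⁱ Rᵢᵏₖⱼ = δNᵏⱼ/δxᵏ - δNᵏₖ/δxʲ`, and the commutation rule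
`∂/∂yˡ (δf/δxʲ) = δ/δxʲ (∂f/∂yˡ) - Γᵐⱼₗ ∂f/∂yᵐ` (`IsLocalMetric.pdy_hd_chern`) turns the vertical
derivative of the right-hand side into `Rₗᵏₖⱼ`.  For the distortion part, `yⁱ τ_{|i|j} = S_{|j}`
with `S = yⁱ τ_{|i}`, and the same rule reduces the claim to `∂S/∂yˡ = τ_{|l}`
(`IsLocalMetric.pdy_horizS`).  This is the vanishing of the mean Landsberg curvature: Jacobi's
formula gives `τ_{|i} = Γᵐₘᵢ - ∂(log ρ)/∂xⁱ`, and `yⁱ ∂Γᵐₘᵢ/∂yˡ = 0` because `∂Γᵐₖᵢ/∂yˡ` is totally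
symmetric in `k`, `i`, `l` and `Γ` is homogeneous of degree zero.

Since geodesics exist for all initial data in the slit tangent bundle and the derivative along them
is `yⁱ δ/δxⁱ`, the scalar curvature is `Ric^∞ = yʲ A_j = W_{ij} yⁱ yʲ`.  Now fix a point of the
manifold, so that `σ` is a constant on the fibre.  Differentiating `A_j = ½ σ [F²]_{yʲ}` in `y`
turns the asymmetric equation into the essential one, and differentiating `yʲ A_j = σ F²` turns the
gradient equation into the symmetric one.  The converses follow by inserting `y` for the free
vectors.
-/

noncomputable section

namespace Finsler

/-! ### Determinants of matrix-valued functions -/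

section Determinant

variable {X : Type*} [NormedAddCommGroup X] [NormedSpace ℝ X] {n : ℕ}
  {A : X → Matrix (Fin n) (Fin n) ℝ} {s : Set X}

theorem contDiffOn_det (hA : ∀ i j, ContDiffOn ℝ ∞ (fun x => A x i j) s) :
    ContDiffOn ℝ ∞ (fun x => (A x).det) s := by
  simp only [Matrix.det_apply']
  exact ContDiffOn.sum fun σ _ => contDiffOn_const.mul (contDiffOn_prod fun i _ => hA _ _)

theorem contDiffOn_inv_apply (hA : ∀ i j, ContDiffOn ℝ ∞ (fun x => A x i j) s)
    (h0 : ∀ x ∈ s, (A x).det ≠ 0) (i j : Fin n) : ContDiffOn ℝ ∞ (fun x => (A x)⁻¹ i j) s := by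
  simp only [Matrix.inv_def, Ring.inverse_eq_inv', Matrix.smul_apply, smul_eq_mul,
    Matrix.adjugate_apply]
  refine ((contDiffOn_det hA).inv h0).mul (contDiffOn_det fun k l => ?_)
  by_cases hk : k = j
  · subst hk
    simpa using contDiffOn_const
  · simpa [Matrix.updateRow_ne hk] using hA k l

/-- Jacobi's formula `d(det A) = tr(adj(A) dA)`. -/
theorem fderiv_det_apply {p : X} (hA : ∀ i j, DifferentiableAt ℝ (fun x => A x i j) p) (v : X) :
    fderiv ℝ (fun x => (A x).det) p v =
      ∑ i, ∑ k, (A p).adjugate i k * fderiv ℝ (fun x => A x k i) p v := by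
  have h1 : HasFDerivAt (fun x => (A x).det)
      (∑ σ : Equiv.Perm (Fin n), ((Equiv.Perm.sign σ : ℤ) : ℝ) •
        ∑ i, (∏ j ∈ Finset.univ.erase i, A p (σ j) j) • fderiv ℝ (fun x => A x (σ i) i) p) p := by
    simp only [Matrix.det_apply']
    exact HasFDerivAt.fun_sum fun σ _ =>
      (HasFDerivAt.finsetProd fun i _ => (hA (σ i) i).hasFDerivAt).const_mul _
  -- The derivative of the `i`-th column contributes the determinant with that column replaced.
  have h2 : ∀ i, ∑ k, (A p).adjugate i k * fderiv ℝ (fun x => A x k i) p v =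
      ((A p).updateCol i fun k => fderiv ℝ (fun x => A x k i) p v).det := by
    intro i
    rw [← Matrix.cramer_apply, Matrix.cramer_eq_adjugate_mulVec]
    rfl
  rw [h1.fderiv]
  simp only [h2, Matrix.det_apply']
  rw [Finset.sum_comm]
  simp only [sum_apply, smul_apply, smul_eq_mul, Finset.mul_sum]
  refine Finset.sum_congr rfl fun σ _ => Finset.sum_congr rfl fun i _ => ?_
  rw [← Finset.mul_prod_erase _ _ (Finset.mem_univ i)]
  have : ∏ j ∈ Finset.univ.erase i,
      (A p).updateCol i (fun k => fderiv ℝ (fun x => A x k i) p v) (σ j) j =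
      ∏ j ∈ Finset.univ.erase i, A p (σ j) j :=
    Finset.prod_congr rfl fun j hj => by rw [Matrix.updateCol_ne (Finset.ne_of_mem_erase hj)]
  rw [this, Matrix.updateCol_self]
  ring

end Determinant

section CoordinatePatch

variable {n : ℕ} {U : Set (E n)} {F f h : E n × E n → ℝ} {ρ : E n → ℝ} {p : E n × E n}

/-! ### Partial derivatives on the slit tangent bundle -/

/-- The slit tangent bundle `TU₀ = U × (ℝⁿ \ {0})` of a coordinate patch `U`. -/
def slit (U : Set (E n)) : Set (E n × E n) := U ×ˢ {0}ᶜ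

theorem mem_slit : p ∈ slit U ↔ p.1 ∈ U ∧ p.2 ≠ 0 := by simp [slit]

theorem isOpen_slit (hU : IsOpen U) : IsOpen (slit U) := hU.prod isOpen_compl_singleton

theorem differentiableAt_of_slit (hU : IsOpen U) (hf : ContDiffOn ℝ ∞ f (slit U))
    (hp : p ∈ slit U) : DifferentiableAt ℝ f p :=
  (hf.contDiffAt ((isOpen_slit hU).mem_nhds hp)).differentiableAt (by simp)

theorem contDiffOn_fderiv_apply (hU : IsOpen U) (hf : ContDiffOn ℝ ∞ f (slit U))
    (v : E n × E n) : ContDiffOn ℝ ∞ (fun q => fderiv ℝ f q v) (slit U) :=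
  (hf.fderiv_of_isOpen (isOpen_slit hU) (by simp)).clm_apply contDiffOn_const

theorem contDiffOn_pdx (hU : IsOpen U) (hf : ContDiffOn ℝ ∞ f (slit U)) (i : Fin n) :
    ContDiffOn ℝ ∞ (pdx i f) (slit U) :=
  contDiffOn_fderiv_apply hU hf _

theorem contDiffOn_pdy (hU : IsOpen U) (hf : ContDiffOn ℝ ∞ f (slit U)) (i : Fin n) :
    ContDiffOn ℝ ∞ (pdy i f) (slit U) :=
  contDiffOn_fderiv_apply hU hf _

theorem contDiffOn_snd_apply (i : Fin n) (s : Set (E n × E n)) :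
    ContDiffOn ℝ ∞ (fun q : E n × E n => q.2 i) s :=
  ((EuclideanSpace.proj (𝕜 := ℝ) i).comp
    (ContinuousLinearMap.snd ℝ (E n) (E n))).contDiff.contDiffOn

theorem fderiv_snd_apply (i : Fin n) (p v : E n × E n) :
    fderiv ℝ (fun q : E n × E n => q.2 i) p v = v.2 i := by
  have := ((EuclideanSpace.proj (𝕜 := ℝ) i).comp
    (ContinuousLinearMap.snd ℝ (E n) (E n))).hasFDerivAt (x := p)
  exact congrArg (fun L => L v) this.fderiv

theorem fderiv_congr_slit (hU : IsOpen U) (hfh : Set.EqOn f h (slit U)) (hp : p ∈ slit U) :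
    fderiv ℝ f p = fderiv ℝ h p :=
  (hfh.eventuallyEq_of_mem ((isOpen_slit hU).mem_nhds hp)).fderiv_eq

theorem fderiv_fderiv_comm (hU : IsOpen U) (hf : ContDiffOn ℝ ∞ f (slit U)) (hp : p ∈ slit U)
    (v w : E n × E n) :
    fderiv ℝ (fun q => fderiv ℝ f q v) p w = fderiv ℝ (fun q => fderiv ℝ f q w) p v := by
  have hc := hf.contDiffAt ((isOpen_slit hU).mem_nhds hp)
  have hd : DifferentiableAt ℝ (fderiv ℝ f) p :=
    (hc.fderiv_right (m := ∞) (by simp)).differentiableAt (by simp)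
  have key : ∀ a b : E n × E n,
      fderiv ℝ (fun q => fderiv ℝ f q a) p b = fderiv ℝ (fderiv ℝ f) p b a := by
    intro a b
    rw [fderiv_clm_apply hd (differentiableAt_const a)]
    simp
  rw [key, key]
  exact (hc.isSymmSndFDerivAt (by
    rw [minSmoothness_of_isRCLikeNormedField]
    exact ENat.LEInfty.out)).eq _ _

theorem pdy_pdy_comm (hU : IsOpen U) (hf : ContDiffOn ℝ ∞ f (slit U)) (hp : p ∈ slit U)
    (i j : Fin n) : pdy i (pdy j f) p = pdy j (pdy i f) p :=
  fderiv_fderiv_comm hU hf hp _ _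

theorem pdy_pdx_comm (hU : IsOpen U) (hf : ContDiffOn ℝ ∞ f (slit U)) (hp : p ∈ slit U)
    (i j : Fin n) : pdy i (pdx j f) p = pdx j (pdy i f) p :=
  fderiv_fderiv_comm hU hf hp _ _

theorem fderiv_sum_apply {f : Fin n → E n × E n → ℝ} (hf : ∀ i, DifferentiableAt ℝ (f i) p)
    (v : E n × E n) :
    fderiv ℝ (fun q => ∑ i, f i q) p v = ∑ i, fderiv ℝ (f i) p v := by
  rw [fderiv_fun_sum fun i _ => hf i, sum_apply]

theorem fderiv_mul_apply (hf : DifferentiableAt ℝ f p) (hh : DifferentiableAt ℝ h p)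
    (v : E n × E n) :
    fderiv ℝ (fun q => f q * h q) p v = fderiv ℝ f p v * h p + f p * fderiv ℝ h p v := by
  rw [fderiv_fun_mul hf hh]
  simp only [add_apply, smul_apply, smul_eq_mul]
  ring

theorem fderiv_sum_snd_mul {f : Fin n → E n × E n → ℝ} (hf : ∀ i, DifferentiableAt ℝ (f i) p)
    (v : E n × E n) :
    fderiv ℝ (fun q => ∑ i, q.2 i * f i q) p v =
      ∑ i, (v.2 i * f i p + p.2 i * fderiv ℝ (f i) p v) := by
  have hy : ∀ i, DifferentiableAt ℝ (fun q : E n × E n => q.2 i) p := fun i =>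
    ((contDiffOn_snd_apply i Set.univ).contDiffAt Filter.univ_mem).differentiableAt (by simp)
  rw [fderiv_sum_apply (f := fun i q => q.2 i * f i q) fun i => (hy i).mul (hf i)]
  simp only [fderiv_mul_apply (hy _) (hf _), fderiv_snd_apply]

theorem sum_smul_single (y : E n) : ∑ i, y i • EuclideanSpace.single i (1 : ℝ) = y := by
  ext j
  simp [Finset.sum_apply, Pi.single_apply]

theorem fderiv_prod_apply (f : E n × E n → ℝ) (p v : E n × E n) :
    fderiv ℝ f p v = ∑ i, v.1 i * pdx i f p + ∑ i, v.2 i * pdy i f p := by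
  have h1 : v = ∑ i, v.1 i • ((EuclideanSpace.single i (1 : ℝ), 0) : E n × E n)
      + ∑ i, v.2 i • ((0, EuclideanSpace.single i (1 : ℝ)) : E n × E n) := by
    refine Prod.ext ?_ ?_ <;> simp [Prod.fst_sum, Prod.snd_sum, sum_smul_single]
  conv_lhs => rw [h1]
  simp only [map_add, map_sum, map_smul, smul_eq_mul, pdx, pdy]

/-! ### Positive homogeneity in the fibre variable -/

/-- `f(x, y)` is positively homogeneous of degree `k` in `y ≠ 0`. -/
def HomogOn (U : Set (E n)) (k : ℕ) (f : E n × E n → ℝ) : Prop :=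
  ∀ p ∈ slit U, ∀ t : ℝ, 0 < t → f (p.1, t • p.2) = t ^ k * f p

theorem smul_mem_slit (hp : p ∈ slit U) {t : ℝ} (ht : 0 < t) : (p.1, t • p.2) ∈ slit U := by
  rw [mem_slit] at hp ⊢
  exact ⟨hp.1, smul_ne_zero ht.ne' hp.2⟩

theorem HomogOn.fderiv_apply {k : ℕ} (hU : IsOpen U) (hf : ContDiffOn ℝ ∞ f (slit U))
    (hk : HomogOn U k f) (hp : p ∈ slit U) {t : ℝ} (ht : 0 < t) (v : E n × E n) :
    fderiv ℝ f (p.1, t • p.2) (v.1, t • v.2) = t ^ k * fderiv ℝ f p v := by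
  let Φ : E n × E n →L[ℝ] E n × E n :=
    (ContinuousLinearMap.id ℝ (E n)).prodMap (t • ContinuousLinearMap.id ℝ (E n))
  have h1 : HasFDerivAt (fun q => f (Φ q)) ((fderiv ℝ f (Φ p)).comp Φ) p :=
    (differentiableAt_of_slit hU hf (smul_mem_slit hp ht)).hasFDerivAt.comp p Φ.hasFDerivAt
  have h2 : fderiv ℝ (fun q => f (Φ q)) p = fderiv ℝ (fun q => t ^ k * f q) p :=
    fderiv_congr_slit hU (fun q hq => hk q hq t ht) hp
  rw [h1.fderiv, fderiv_const_mul (differentiableAt_of_slit hU hf hp)] at h2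
  exact congrArg (fun L => L v) h2

theorem HomogOn.pdy {k : ℕ} (hU : IsOpen U) (hf : ContDiffOn ℝ ∞ f (slit U))
    (hk : HomogOn U (k + 1) f) (i : Fin n) : HomogOn U k (pdy i f) := by
  intro p hp t ht
  have h := hk.fderiv_apply hU hf hp ht (0, EuclideanSpace.single i 1)
  have h0 : ((0, t • EuclideanSpace.single i 1) : E n × E n)
      = t • (0, EuclideanSpace.single i 1) := by simp
  simp only [h0, map_smul, smul_eq_mul] at h
  have := ht.ne'
  refine mul_left_cancel₀ this (h.trans ?_)
  rw [Finsler.pdy]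
  ring

theorem HomogOn.pdx {k : ℕ} (hU : IsOpen U) (hf : ContDiffOn ℝ ∞ f (slit U))
    (hk : HomogOn U k f) (i : Fin n) : HomogOn U k (pdx i f) := by
  intro p hp t ht
  have h := hk.fderiv_apply hU hf hp ht (EuclideanSpace.single i 1, 0)
  simp only [smul_zero] at h
  exact h

/-- Euler's theorem on homogeneous functions. -/
theorem HomogOn.euler {k : ℕ} (hU : IsOpen U) (hf : ContDiffOn ℝ ∞ f (slit U))
    (hk : HomogOn U k f) (hp : p ∈ slit U) : ∑ i, p.2 i * Finsler.pdy i f p = k * f p := by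
  have hline : HasDerivAt (fun t : ℝ => ((p.1, t • p.2) : E n × E n)) (0, p.2) 1 := by
    have := (hasDerivAt_id (1 : ℝ)).smul_const p.2
    simpa using (hasDerivAt_const (1 : ℝ) p.1).prodMk this
  have hd : HasFDerivAt f (fderiv ℝ f p) ((p.1, (1 : ℝ) • p.2) : E n × E n) := by
    simpa using (differentiableAt_of_slit hU hf hp).hasFDerivAt
  have h1 := hd.comp_hasDerivAt (1 : ℝ) hline
  have h2 : HasDerivAt (fun t : ℝ => t ^ k * f p) (k * f p) 1 := by
    simpa using (hasDerivAt_pow k (1 : ℝ)).mul_const (f p)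
  have h3 : (fun t : ℝ => t ^ k * f p) =ᶠ[nhds 1] fun t => f (p.1, t • p.2) := by
    filter_upwards [lt_mem_nhds (zero_lt_one' ℝ)] with t ht using (hk p hp t ht).symm
  have h4 := (h1.congr_of_eventuallyEq h3).unique h2
  rw [fderiv_prod_apply] at h4
  simpa using h4

/-! ### Local Finsler metrics -/

/-- `F` is a Finsler metric on the open coordinate patch `U`. -/
structure IsLocalMetric (F : E n × E n → ℝ) (U : Set (E n)) : Prop where
  isOpen : IsOpen U
  smooth : ContDiffOn ℝ ∞ F (slit U)
  homog : HomogOn U 1 F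
  posDef : ∀ p ∈ slit U, (fundMatrix F p).PosDef

namespace IsLocalMetric

theorem smooth_sq (hF : IsLocalMetric F U) : ContDiffOn ℝ ∞ (fun q => F q ^ 2) (slit U) :=
  hF.smooth.pow 2

theorem homog_sq (hF : IsLocalMetric F U) : HomogOn U 2 fun q => F q ^ 2 := by
  intro p hp t ht
  simp only [hF.homog p hp t ht]
  ring

theorem homog_pdy_sq (hF : IsLocalMetric F U) (j : Fin n) :
    HomogOn U 1 (pdy j fun q => F q ^ 2) :=
  HomogOn.pdy hF.isOpen hF.smooth_sq hF.homog_sq j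

theorem smooth_pdy_sq (hF : IsLocalMetric F U) (j : Fin n) :
    ContDiffOn ℝ ∞ (pdy j fun q => F q ^ 2) (slit U) :=
  contDiffOn_pdy hF.isOpen hF.smooth_sq j

theorem smooth_g (hF : IsLocalMetric F U) (i j : Fin n) : ContDiffOn ℝ ∞ (g F i j) (slit U) :=
  contDiffOn_const.mul (contDiffOn_pdy hF.isOpen (hF.smooth_pdy_sq j) i)

theorem smooth_gInv (hF : IsLocalMetric F U) (i j : Fin n) :
    ContDiffOn ℝ ∞ (gInv F i j) (slit U) :=
  contDiffOn_inv_apply (A := fundMatrix F) hF.smooth_g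
    (fun p hp => (hF.posDef p hp).det_pos.ne') i j

theorem smooth_spray (hF : IsLocalMetric F U) (i : Fin n) :
    ContDiffOn ℝ ∞ (spray F i) (slit U) :=
  contDiffOn_const.mul <| ContDiffOn.sum fun j _ => (hF.smooth_gInv i j).mul <|
    (ContDiffOn.sum fun k _ => (contDiffOn_pdx hF.isOpen (hF.smooth_pdy_sq j) k).mul
      (contDiffOn_snd_apply k _)).sub (contDiffOn_pdx hF.isOpen hF.smooth_sq j)

theorem smooth_nonlin (hF : IsLocalMetric F U) (i j : Fin n) :
    ContDiffOn ℝ ∞ (nonlin F i j) (slit U) :=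
  contDiffOn_pdy hF.isOpen (hF.smooth_spray i) j

theorem smooth_hd (hF : IsLocalMetric F U) (hf : ContDiffOn ℝ ∞ f (slit U)) (i : Fin n) :
    ContDiffOn ℝ ∞ (hd F i f) (slit U) :=
  (contDiffOn_pdx hF.isOpen hf i).sub <| ContDiffOn.sum fun j _ =>
    (hF.smooth_nonlin j i).mul (contDiffOn_pdy hF.isOpen hf j)

theorem smooth_chern (hF : IsLocalMetric F U) (i j k : Fin n) :
    ContDiffOn ℝ ∞ (chern F i j k) (slit U) :=
  contDiffOn_const.mul <| ContDiffOn.sum fun l _ => (hF.smooth_gInv i l).mul <|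
    ((hF.smooth_hd (hF.smooth_g j l) k).add (hF.smooth_hd (hF.smooth_g l k) j)).sub
      (hF.smooth_hd (hF.smooth_g j k) l)

theorem homog_fundMatrix (hF : IsLocalMetric F U) (hp : p ∈ slit U) {t : ℝ} (ht : 0 < t) :
    fundMatrix F (p.1, t • p.2) = fundMatrix F p := by
  ext i j
  have := HomogOn.pdy (k := 0) hF.isOpen (hF.smooth_pdy_sq j) (hF.homog_pdy_sq j) i p hp t ht
  simp only [fundMatrix, Matrix.of_apply, this, pow_zero, one_mul]

theorem homog_spray (hF : IsLocalMetric F U) (i : Fin n) : HomogOn U 2 (spray F i) := by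
  intro p hp t ht
  have h1 := fun j k => (hF.homog_pdy_sq j).pdx hF.isOpen (hF.smooth_pdy_sq j) k p hp t ht
  have h2 := fun j => hF.homog_sq.pdx hF.isOpen hF.smooth_sq j p hp t ht
  simp only [spray, gInv, hF.homog_fundMatrix hp ht, h1, h2, PiLp.smul_apply, smul_eq_mul,
    Finset.mul_sum]
  refine Finset.sum_congr rfl fun j _ => ?_
  have h3 : ∑ k, t ^ 1 * pdx k (pdy j fun q => F q ^ 2) p * (t * p.2 k) =
      t ^ 2 * ∑ k, pdx k (pdy j fun q => F q ^ 2) p * p.2 k := by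
    rw [Finset.mul_sum]
    exact Finset.sum_congr rfl fun k _ => by ring
  rw [h3]
  ring

theorem homog_nonlin (hF : IsLocalMetric F U) (i j : Fin n) : HomogOn U 1 (nonlin F i j) :=
  HomogOn.pdy hF.isOpen (hF.smooth_spray i) (hF.homog_spray i) j

theorem sum_nonlin_mul (hF : IsLocalMetric F U) (hp : p ∈ slit U) (i : Fin n) :
    ∑ j, p.2 j * nonlin F i j p = 2 * spray F i p := by
  have h := (hF.homog_spray i).euler hF.isOpen (hF.smooth_spray i) hp
  simp only [Nat.cast_ofNat] at h
  exact h

theorem sum_g_mul (hF : IsLocalMetric F U) (hp : p ∈ slit U) (j : Fin n) :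
    ∑ i, p.2 i * g F i j p = (1 / 2) * pdy j (fun q => F q ^ 2) p := by
  have := (hF.homog_pdy_sq j).euler hF.isOpen (hF.smooth_pdy_sq j) hp
  simp only [Nat.cast_one, one_mul] at this
  rw [← this, Finset.mul_sum]
  refine Finset.sum_congr rfl fun i _ => ?_
  simp only [g, fundMatrix, Matrix.of_apply]
  ring

theorem g_symm (hF : IsLocalMetric F U) (hp : p ∈ slit U) (i j : Fin n) :
    g F i j p = g F j i p :=
  (hF.posDef p hp).isHermitian.apply j i

theorem gInv_symm (hF : IsLocalMetric F U) (hp : p ∈ slit U) (i j : Fin n) :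
    gInv F i j p = gInv F j i p :=
  (hF.posDef p hp).isHermitian.inv.apply j i

end IsLocalMetric

/-! ### Horizontal derivatives -/

/-- The horizontal vector `δ/δxⁱ = ∂/∂xⁱ - Nʲᵢ ∂/∂yʲ`. -/
def hvec (F : E n × E n → ℝ) (i : Fin n) (p : E n × E n) : E n × E n :=
  (EuclideanSpace.single i 1, WithLp.toLp 2 fun j => -nonlin F j i p)

theorem hd_eq_fderiv (F f : E n × E n → ℝ) (i : Fin n) (p : E n × E n) :
    hd F i f p = fderiv ℝ f p (hvec F i p) := by
  rw [fderiv_prod_apply]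
  simp [hd, hvec, sub_eq_add_neg]

namespace IsLocalMetric

theorem hd_sum_snd_mul (hF : IsLocalMetric F U) {f : Fin n → E n × E n → ℝ}
    (hf : ∀ i, ContDiffOn ℝ ∞ (f i) (slit U)) (hp : p ∈ slit U) (k : Fin n) :
    hd F k (fun q => ∑ i, q.2 i * f i q) p =
      ∑ i, p.2 i * hd F k (f i) p - ∑ i, nonlin F i k p * f i p := by
  simp only [hd_eq_fderiv]
  rw [fderiv_sum_snd_mul fun i => differentiableAt_of_slit hF.isOpen (hf i) hp]
  simp [hvec, Finset.sum_add_distrib]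
  ring

/-- The commutator of a vertical and a horizontal coordinate derivative is vertical, with
coefficients `∂Nᵐⱼ/∂yˡ`. -/
theorem pdy_hd (hF : IsLocalMetric F U) (hf : ContDiffOn ℝ ∞ f (slit U)) (hp : p ∈ slit U)
    (l j : Fin n) :
    pdy l (hd F j f) p =
      hd F j (pdy l f) p - ∑ m, pdy l (nonlin F m j) p * pdy m f p := by
  have hx := differentiableAt_of_slit hF.isOpen (contDiffOn_pdx hF.isOpen hf j) hp
  have hy := fun m => differentiableAt_of_slit hF.isOpen (contDiffOn_pdy hF.isOpen hf m) hp
  have hN := fun m => differentiableAt_of_slit hF.isOpen (hF.smooth_nonlin m j) hp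
  have h1 : pdy l (hd F j f) p = pdy l (pdx j f) p -
      ∑ m, (pdy l (nonlin F m j) p * pdy m f p + nonlin F m j p * pdy l (pdy m f) p) := by
    have hS : DifferentiableAt ℝ (fun q => ∑ m, nonlin F m j q * pdy m f q) p :=
      DifferentiableAt.fun_sum fun m _ => (hN m).mul (hy m)
    change fderiv ℝ (fun q => pdx j f q - ∑ m, nonlin F m j q * pdy m f q) p _ = _
    rw [fderiv_fun_sub hx hS, sub_apply,
      fderiv_sum_apply (f := fun m q => nonlin F m j q * pdy m f q) fun m => (hN m).mul (hy m)]
    simp only [fderiv_mul_apply (hN _) (hy _)]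
    rfl
  rw [h1, hd, pdy_pdx_comm hF.isOpen hf hp, Finset.sum_add_distrib]
  simp only [pdy_pdy_comm hF.isOpen hf hp l]
  ring

/-! ### The distortion -/

theorem smooth_log_density (hρ : ContDiffOn ℝ ∞ ρ U) (hρ0 : ∀ u ∈ U, 0 < ρ u) :
    ContDiffOn ℝ ∞ (fun q : E n × E n => Real.log (ρ q.1)) (slit U) :=
  ContDiffOn.log (hρ.comp contDiffOn_fst fun _ hq => (mem_slit.1 hq).1)
    fun _ hq => (hρ0 _ (mem_slit.1 hq).1).ne'

theorem distortion_eqOn (hF : IsLocalMetric F U) (hρ0 : ∀ u ∈ U, 0 < ρ u) :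
    Set.EqOn (distortion F ρ)
      (fun q => (1 / 2) * Real.log (fundMatrix F q).det - Real.log (ρ q.1)) (slit U) := by
  intro q hq
  have h1 := (hF.posDef q hq).det_pos
  simp only [distortion]
  rw [Real.log_div (Real.sqrt_pos.2 h1).ne' (hρ0 _ (mem_slit.1 hq).1).ne', Real.log_sqrt h1.le]
  ring

theorem smooth_distortion (hF : IsLocalMetric F U) (hρ : ContDiffOn ℝ ∞ ρ U)
    (hρ0 : ∀ u ∈ U, 0 < ρ u) : ContDiffOn ℝ ∞ (distortion F ρ) (slit U) :=
  ((contDiffOn_const.mul ((contDiffOn_det (A := fundMatrix F) hF.smooth_g).log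
    fun q hq => (hF.posDef q hq).det_pos.ne')).sub (smooth_log_density hρ hρ0)).congr
      (hF.distortion_eqOn hρ0)

theorem fderiv_distortion (hF : IsLocalMetric F U) (hρ : ContDiffOn ℝ ∞ ρ U)
    (hρ0 : ∀ u ∈ U, 0 < ρ u) (hp : p ∈ slit U) (v : E n × E n) :
    fderiv ℝ (distortion F ρ) p v =
      (1 / 2) * ∑ i, ∑ l, gInv F i l p * fderiv ℝ (g F l i) p v -
        fderiv ℝ (fun q : E n × E n => Real.log (ρ q.1)) p v := by
  have hdet := differentiableAt_of_slit hF.isOpen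
    (contDiffOn_det (A := fundMatrix F) hF.smooth_g) hp
  have h0 := (hF.posDef p hp).det_pos.ne'
  rw [fderiv_congr_slit hF.isOpen (hF.distortion_eqOn hρ0) hp,
    fderiv_fun_sub ((hdet.log h0).const_mul _)
      (differentiableAt_of_slit hF.isOpen (smooth_log_density hρ hρ0) hp),
    sub_apply, fderiv_const_mul (hdet.log h0), fderiv.log hdet h0]
  simp only [smul_apply, smul_eq_mul]
  rw [fderiv_det_apply (A := fundMatrix F)
    fun i j => differentiableAt_of_slit hF.isOpen (hF.smooth_g i j) hp]
  congr 2
  simp only [Finset.mul_sum, gInv, Matrix.inv_def, Ring.inverse_eq_inv', Matrix.smul_apply,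
    smul_eq_mul, mul_assoc]
  rfl

/-- `τ_{|i} = Γᵐₘᵢ - ∂(log ρ)/∂xⁱ`. -/
theorem hd_distortion (hF : IsLocalMetric F U) (hρ : ContDiffOn ℝ ∞ ρ U)
    (hρ0 : ∀ u ∈ U, 0 < ρ u) (hp : p ∈ slit U) (i : Fin n) :
    hd F i (distortion F ρ) p =
      ∑ m, chern F m m i p - pdx i (fun q : E n × E n => Real.log (ρ q.1)) p := by
  have hlog : fderiv ℝ (fun q : E n × E n => Real.log (ρ q.1)) p (hvec F i p) =
      pdx i (fun q : E n × E n => Real.log (ρ q.1)) p := by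
    have hρp : DifferentiableAt ℝ (fun u => Real.log (ρ u)) p.1 :=
      (((hρ.contDiffAt (hF.isOpen.mem_nhds (mem_slit.1 hp).1)).differentiableAt (by simp)).log
        (hρ0 _ (mem_slit.1 hp).1).ne')
    have : HasFDerivAt (fun q : E n × E n => Real.log (ρ q.1))
        ((fderiv ℝ (fun u => Real.log (ρ u)) p.1).comp (ContinuousLinearMap.fst ℝ (E n) (E n))) p :=
      hρp.hasFDerivAt.comp p hasFDerivAt_fst
    rw [pdx, this.fderiv]
    rfl
  have hsymm : ∀ l m k, hd F k (g F l m) p = hd F k (g F m l) p := fun l m k => by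
    rw [hd_eq_fderiv, hd_eq_fderiv,
      fderiv_congr_slit hF.isOpen (fun q hq => hF.g_symm hq l m) hp]
  rw [hd_eq_fderiv, hF.fderiv_distortion hρ hρ0 hp, hlog]
  simp only [← hd_eq_fderiv, chern, ← Finset.mul_sum]
  congr 2
  -- Two of the three terms of the trace `Γᵐₘᵢ` cancel since `g^{ml}` is symmetric.
  have hswap : ∑ m, ∑ l, gInv F m l p * hd F m (g F l i) p =
      ∑ m, ∑ l, gInv F m l p * hd F l (g F m i) p := by
    rw [Finset.sum_comm]
    exact Finset.sum_congr rfl fun m _ => Finset.sum_congr rfl fun l _ => by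
      rw [hF.gInv_symm hp l m]
  simp only [mul_sub, mul_add, Finset.sum_add_distrib, Finset.sum_sub_distrib, hswap,
    add_sub_cancel_right]
  exact Finset.sum_congr rfl fun m _ => Finset.sum_congr rfl fun l _ => by rw [hsymm l m]

end IsLocalMetric

/-! ### The weighted Ricci tensor of a Landsberg metric -/

/-- `yⁱ τ_{|i}`, the derivative of the distortion along the geodesic spray. -/
def horizS (F : E n × E n → ℝ) (ρ : E n → ℝ) (p : E n × E n) : ℝ :=
  ∑ i, p.2 i * hd F i (distortion F ρ) p

/-- The covector `δNᵏⱼ/δxᵏ - δNᵏₖ/δxʲ + S_{|j}`, which for a Landsberg metric is the contraction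
`Ric^∞_y(y, ∂/∂xʲ)`. -/
def ricCovector (F : E n × E n → ℝ) (ρ : E n → ℝ) (j : Fin n) (p : E n × E n) : ℝ :=
  ∑ k, (hd F k (nonlin F k j) p - hd F j (nonlin F k k) p) + hd F j (horizS F ρ) p

namespace IsLocalMetric

section Landsberg

variable (hF : IsLocalMetric F U) (hL : ∀ p ∈ slit U, ∀ i j k, landsberg F i j k p = 0)

include hL in
theorem pdy_nonlin (hp : p ∈ slit U) (i j k : Fin n) :
    pdy k (nonlin F i j) p = chern F i j k p :=
  sub_eq_zero.1 (hL p hp i j k)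

include hF hL

theorem chern_symm (hp : p ∈ slit U) (i j k : Fin n) : chern F i j k p = chern F i k j p := by
  rw [← pdy_nonlin hL hp, ← pdy_nonlin hL hp]
  exact pdy_pdy_comm hF.isOpen (hF.smooth_spray i) hp k j

theorem sum_mul_chern (hp : p ∈ slit U) (k j : Fin n) :
    ∑ i, p.2 i * chern F k i j p = nonlin F k j p := by
  have h := (hF.homog_nonlin k j).euler hF.isOpen (hF.smooth_nonlin k j) hp
  simp only [Nat.cast_one, one_mul] at h
  simp only [← h, pdy_nonlin hL hp]
  exact Finset.sum_congr rfl fun i _ => by rw [hF.chern_symm hL hp]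

/-- The vertical derivative of the Chern coefficients is symmetric and has vanishing contraction
with `y`, since these coefficients are the third derivatives of a function of degree two. -/
theorem sum_mul_pdy_chern (hp : p ∈ slit U) (i j l : Fin n) :
    ∑ k, p.2 k * pdy l (chern F i j k) p = 0 := by
  have heq : ∀ j k, Set.EqOn (chern F i j k) (pdy k (nonlin F i j)) (slit U) :=
    fun j k q hq => (pdy_nonlin hL hq i j k).symm
  have h1 : HomogOn U 0 (pdy l (nonlin F i j)) :=
    HomogOn.pdy hF.isOpen (hF.smooth_nonlin i j) (hF.homog_nonlin i j) l
  have h2 := h1.euler hF.isOpen (contDiffOn_pdy hF.isOpen (hF.smooth_nonlin i j) l) hp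
  simp only [Nat.cast_zero, zero_mul] at h2
  rw [← h2]
  refine Finset.sum_congr rfl fun k _ => ?_
  rw [← pdy_pdy_comm hF.isOpen (hF.smooth_nonlin i j) hp l k]
  conv_lhs => rw [pdy, fderiv_congr_slit hF.isOpen (heq j k) hp]
  rfl

/-- For a Landsberg metric the commutator of a vertical and a horizontal derivative is governed by
the Chern connection. -/
theorem pdy_hd_chern (hf : ContDiffOn ℝ ∞ f (slit U)) (hp : p ∈ slit U) (l j : Fin n) :
    pdy l (hd F j f) p = hd F j (pdy l f) p - ∑ m, chern F m j l p * pdy m f p := by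
  rw [hF.pdy_hd hf hp]
  simp only [pdy_nonlin hL hp]

theorem pdy_hd_nonlin (hp : p ∈ slit U) (a b l j : Fin n) :
    pdy l (hd F j (nonlin F a b)) p =
      hd F j (chern F a b l) p - ∑ m, chern F m j l p * chern F a b m p := by
  rw [hF.pdy_hd_chern hL (hF.smooth_nonlin a b) hp]
  simp only [pdy_nonlin hL hp]
  rw [hd_eq_fderiv, hd_eq_fderiv,
    fderiv_congr_slit hF.isOpen (fun q hq => pdy_nonlin hL hq a b l) hp]

theorem hd_nonlin (hp : p ∈ slit U) (a b k : Fin n) :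
    hd F k (nonlin F a b) p =
      ∑ i, p.2 i * hd F k (chern F a i b) p - ∑ i, nonlin F i k p * chern F a i b p := by
  rw [← hF.hd_sum_snd_mul (fun i => hF.smooth_chern a i b) hp, hd_eq_fderiv, hd_eq_fderiv,
    fderiv_congr_slit hF.isOpen (fun q hq => (hF.sum_mul_chern hL hq a b).symm) hp]

theorem hd_chern_symm (hp : p ∈ slit U) (a b c k : Fin n) :
    hd F k (chern F a b c) p = hd F k (chern F a c b) p := by
  rw [hd_eq_fderiv, hd_eq_fderiv,
    fderiv_congr_slit hF.isOpen (fun q hq => hF.chern_symm hL hq a b c) hp]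

theorem sum_mul_chernRiem (hp : p ∈ slit U) (k j : Fin n) :
    ∑ i, p.2 i * chernRiem F i k k j p =
      hd F k (nonlin F k j) p - hd F j (nonlin F k k) p := by
  rw [hF.hd_nonlin hL hp, hF.hd_nonlin hL hp]
  simp only [chernRiem, mul_add, mul_sub, Finset.sum_add_distrib, Finset.sum_sub_distrib,
    Finset.mul_sum]
  have hc : ∀ a b, ∑ i, ∑ m, p.2 i * (chern F k a m p * chern F m i b p) =
      ∑ m, nonlin F m b p * chern F k m a p := by
    intro a b
    rw [Finset.sum_comm]
    refine Finset.sum_congr rfl fun m _ => ?_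
    rw [← hF.sum_mul_chern hL hp m b, Finset.sum_mul]
    exact Finset.sum_congr rfl fun i _ => by rw [hF.chern_symm hL hp k a m]; ring
  rw [hc, hc]
  ring

/-- The curvature `δNᵏⱼ/δxᵏ - δNᵏₖ/δxʲ` of the nonlinear connection determines the Chern
curvature by vertical differentiation. -/
theorem pdy_curvature (hp : p ∈ slit U) (k j l : Fin n) :
    pdy l (hd F k (nonlin F k j)) p - pdy l (hd F j (nonlin F k k)) p =
      chernRiem F l k k j p := by
  rw [hF.pdy_hd_nonlin hL hp, hF.pdy_hd_nonlin hL hp, chernRiem, hF.hd_chern_symm hL hp k j l,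
    hF.hd_chern_symm hL hp k k l, Finset.sum_sub_distrib]
  have hc : ∀ a b, ∑ m, chern F m a l p * chern F k b m p =
      ∑ m, chern F k b m p * chern F m l a p :=
    fun a b => Finset.sum_congr rfl fun m _ => by rw [hF.chern_symm hL hp m a l]; ring
  rw [hc, hc]
  ring

variable (hρ : ContDiffOn ℝ ∞ ρ U) (hρ0 : ∀ u ∈ U, 0 < ρ u)

omit hL in
include hρ hρ0 in
theorem smooth_horizS : ContDiffOn ℝ ∞ (horizS F ρ) (slit U) :=
  ContDiffOn.sum fun i _ => (contDiffOn_snd_apply i _).mul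
    (hF.smooth_hd (hF.smooth_distortion hρ hρ0) i)

include hρ hρ0

/-- The mean Landsberg curvature vanishes, so that `∂S/∂yˡ = τ_{|l}`. -/
theorem pdy_horizS (hp : p ∈ slit U) (l : Fin n) :
    pdy l (horizS F ρ) p = hd F l (distortion F ρ) p := by
  have hτ := hF.smooth_distortion hρ hρ0
  have hsm := smooth_log_density hρ hρ0
  have h1 : pdy l (horizS F ρ) p = hd F l (distortion F ρ) p +
      ∑ i, p.2 i * pdy l (hd F i (distortion F ρ)) p := by
    unfold pdy horizS
    rw [fderiv_sum_snd_mul fun i => differentiableAt_of_slit hF.isOpen (hF.smooth_hd hτ i) hp,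
      Finset.sum_add_distrib]
    simp
  -- The density does not depend on `y`, so only the trace of the Chern connection contributes.
  have h2 : ∀ i, pdy l (hd F i (distortion F ρ)) p = ∑ m, pdy l (chern F m m i) p := by
    intro i
    have hlog : pdy l (pdx i fun q : E n × E n => Real.log (ρ q.1)) p = 0 := by
      have h0 : Set.EqOn (pdy l fun q : E n × E n => Real.log (ρ q.1)) (fun _ => 0) (slit U) := by
        intro q hq
        have hρq : DifferentiableAt ℝ (fun u => Real.log (ρ u)) q.1 :=
          (((hρ.contDiffAt (hF.isOpen.mem_nhds (mem_slit.1 hq).1)).differentiableAt (by simp)).log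
            (hρ0 _ (mem_slit.1 hq).1).ne')
        have : HasFDerivAt (fun q : E n × E n => Real.log (ρ q.1))
            ((fderiv ℝ (fun u => Real.log (ρ u)) q.1).comp
              (ContinuousLinearMap.fst ℝ (E n) (E n))) q :=
          hρq.hasFDerivAt.comp q hasFDerivAt_fst
        simp [pdy, this.fderiv]
      rw [pdy_pdx_comm hF.isOpen hsm hp, pdx, fderiv_congr_slit hF.isOpen h0 hp]
      simp
    have hd1 := fun m => differentiableAt_of_slit hF.isOpen (hF.smooth_chern m m i) hp
    have hd2 := differentiableAt_of_slit hF.isOpen (contDiffOn_pdx hF.isOpen hsm i) hp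
    rw [pdy, fderiv_congr_slit hF.isOpen (fun q hq => hF.hd_distortion hρ hρ0 hq i) hp,
      fderiv_fun_sub (DifferentiableAt.fun_sum fun m _ => hd1 m) hd2, sub_apply,
      fderiv_sum_apply hd1]
    change _ - pdy l (pdx i fun q : E n × E n => Real.log (ρ q.1)) p = _
    rw [hlog, sub_zero]
    rfl
  rw [h1]
  simp only [h2, Finset.mul_sum]
  rw [Finset.sum_comm]
  simp only [hF.sum_mul_pdy_chern hL hp, Finset.sum_const_zero, add_zero]

/-- `Ric^∞_y(y, ∂/∂xʲ)` is the covector `ricCovector`. -/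
theorem sum_mul_wRic (hp : p ∈ slit U) (j : Fin n) :
    ∑ i, p.2 i * wRic F ρ i j p = ricCovector F ρ j p := by
  have hτ := hF.smooth_distortion hρ hρ0
  have h1 : ∑ i, p.2 i * ∑ k, chernRiem F i k k j p =
      ∑ k, (hd F k (nonlin F k j) p - hd F j (nonlin F k k) p) := by
    simp only [← hF.sum_mul_chernRiem hL hp, Finset.mul_sum]
    exact Finset.sum_comm
  have h2 : ∑ i, p.2 i * hd2 F (distortion F ρ) i j p = hd F j (horizS F ρ) p := by
    unfold horizS
    rw [hF.hd_sum_snd_mul (fun i => hF.smooth_hd hτ i) hp]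
    simp only [hd2, mul_sub, Finset.sum_sub_distrib, Finset.mul_sum]
    rw [Finset.sum_comm (f := fun i k => p.2 i * (chern F k i j p * hd F k (distortion F ρ) p))]
    congr 1
    refine Finset.sum_congr rfl fun k _ => ?_
    rw [← hF.sum_mul_chern hL hp k j, Finset.sum_mul]
    exact Finset.sum_congr rfl fun i _ => by ring
  simp only [wRic, mul_add, Finset.sum_add_distrib, h1, h2, ricCovector]

/-- The weighted Ricci tensor is the vertical derivative of its contraction with `y`. -/
theorem pdy_ricCovector (hp : p ∈ slit U) (l j : Fin n) :
    pdy l (ricCovector F ρ j) p = wRic F ρ l j p := by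
  have hS := hF.smooth_horizS hρ hρ0
  have d1 : ∀ k a b, DifferentiableAt ℝ (hd F k (nonlin F a b)) p := fun k a b =>
    differentiableAt_of_slit hF.isOpen (hF.smooth_hd (hF.smooth_nonlin a b) k) hp
  have d2 := differentiableAt_of_slit hF.isOpen (hF.smooth_hd hS j) hp
  have h1 : pdy l (ricCovector F ρ j) p =
      ∑ k, (pdy l (hd F k (nonlin F k j)) p - pdy l (hd F j (nonlin F k k)) p) +
        pdy l (hd F j (horizS F ρ)) p := by
    unfold pdy ricCovector
    have d3 : ∀ k, DifferentiableAt ℝ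
        (fun q => hd F k (nonlin F k j) q - hd F j (nonlin F k k) q) p :=
      fun k => (d1 k k j).sub (d1 j k k)
    rw [fderiv_fun_add (DifferentiableAt.fun_sum fun k _ => d3 k) d2, add_apply,
      fderiv_sum_apply d3]
    congr 1
    exact Finset.sum_congr rfl fun k _ => by rw [fderiv_fun_sub (d1 k k j) (d1 j k k), sub_apply]
  rw [h1, wRic, hd2, hF.pdy_hd_chern hL hS hp]
  simp only [hF.pdy_curvature hL hp, hF.pdy_horizS hL hρ hρ0 hp]
  have h2 : hd F j (pdy l (horizS F ρ)) p = hd F j (hd F l (distortion F ρ)) p := by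
    rw [hd_eq_fderiv, hd_eq_fderiv,
      fderiv_congr_slit hF.isOpen (fun q hq => hF.pdy_horizS hL hρ hρ0 hq l) hp]
  rw [h2]
  simp only [hF.chern_symm hL hp _ j l]

omit hL in
theorem smooth_ricCovector (j : Fin n) : ContDiffOn ℝ ∞ (ricCovector F ρ j) (slit U) :=
  (ContDiffOn.sum fun k _ => (hF.smooth_hd (hF.smooth_nonlin k j) k).sub
    (hF.smooth_hd (hF.smooth_nonlin k k) j)).add (hF.smooth_hd (hF.smooth_horizS hρ hρ0) j)

end Landsberg

end IsLocalMetric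

/-! ### Derivatives along geodesics -/

namespace IsLocalMetric

theorem exists_isGeodesicFrom (hF : IsLocalMetric F U) (hp : p ∈ slit U) :
    ∃ γ : ℝ → E n, IsGeodesicFrom F γ p := by
  -- The geodesic equation as a first-order system on the slit tangent bundle.
  let X : E n × E n → E n × E n := fun q => (q.2, WithLp.toLp 2 fun i => -2 * spray F i q)
  have hX : ContDiffAt ℝ 1 X p := by
    refine contDiffAt_snd.prodMk (contDiffAt_euclidean.2 fun i => contDiffAt_const.mul ?_)
    exact ((hF.smooth_spray i).contDiffAt ((isOpen_slit hF.isOpen).mem_nhds hp)).of_le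
      ENat.LEInfty.out
  obtain ⟨α, hα0, ε, hε, hα⟩ :=
    hX.exists_forall_mem_closedBall_exists_eq_forall_mem_Ioo_hasDerivAt₀ 0
  rw [zero_sub, zero_add] at hα
  have h1 : ∀ t ∈ Set.Ioo (-ε) ε, HasDerivAt (fun t => (α t).1) (α t).2 t := fun t ht =>
    (ContinuousLinearMap.fst ℝ (E n) (E n)).hasFDerivAt.comp_hasDerivAt t (hα t ht)
  have h2 : ∀ t ∈ Set.Ioo (-ε) ε, HasDerivAt (fun t => (α t).2)
      (WithLp.toLp 2 fun i => -2 * spray F i (α t)) t := fun t ht =>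
    (ContinuousLinearMap.snd ℝ (E n) (E n)).hasFDerivAt.comp_hasDerivAt t (hα t ht)
  have h3 : ∀ t ∈ Set.Ioo (-ε) ε, deriv (fun t => (α t).1) t = (α t).2 := fun t ht =>
    (h1 t ht).deriv
  have h0 : (0 : ℝ) ∈ Set.Ioo (-ε) ε := ⟨by linarith, hε⟩
  refine ⟨fun t => (α t).1, by simp [hα0], by rw [h3 0 h0, hα0], ?_⟩
  filter_upwards [Ioo_mem_nhds h0.1 h0.2] with t ht
  refine ⟨(h1 t ht).differentiableAt, ?_⟩
  rw [h3 t ht]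
  exact (h2 t ht).congr_of_eventuallyEq
    (Filter.eventuallyEq_of_mem (Ioo_mem_nhds ht.1 ht.2) h3)

/-- The derivative along geodesics is `yⁱ δ/δxⁱ`. -/
theorem geodesicDeriv_eq (hF : IsLocalMetric F U) (hp : p ∈ slit U)
    (hf : DifferentiableAt ℝ f p) : geodesicDeriv F f p = ∑ i, p.2 i * hd F i f p := by
  have hex := hF.exists_isGeodesicFrom hp
  rw [geodesicDeriv, dif_pos hex]
  obtain ⟨h0, h1, h2⟩ := hex.choose_spec
  set γ := hex.choose
  obtain ⟨h3, h4⟩ := h2.self_of_nhds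
  have hc := h3.hasDerivAt.prodMk h4
  have hf' : HasFDerivAt f (fderiv ℝ f p) (γ 0, deriv γ 0) := by
    rw [h0, h1]
    exact hf.hasFDerivAt
  have hmain : deriv (fun t => f (γ t, deriv γ t)) 0 = _ := (hf'.comp_hasDerivAt 0 hc).deriv
  rw [hmain, fderiv_prod_apply, h0, h1]
  simp only [hd, mul_sub, Finset.sum_sub_distrib, Finset.mul_sum]
  rw [Finset.sum_comm (f := fun i j => p.2 i * (nonlin F j i p * pdy j f p)), sub_eq_add_neg,
    ← Finset.sum_neg_distrib]
  congr 1
  refine Finset.sum_congr rfl fun j _ => ?_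
  simp only [← mul_assoc, ← Finset.sum_mul, hF.sum_nonlin_mul hp]
  ring

theorem sCurv_eq (hF : IsLocalMetric F U) (hρ : ContDiffOn ℝ ∞ ρ U) (hρ0 : ∀ u ∈ U, 0 < ρ u)
    (hp : p ∈ slit U) : sCurv F ρ p = horizS F ρ p :=
  hF.geodesicDeriv_eq hp
    (differentiableAt_of_slit hF.isOpen (hF.smooth_distortion hρ hρ0) hp)

theorem ricInfScalar_eq (hF : IsLocalMetric F U)
    (hL : ∀ p ∈ slit U, ∀ i j k, landsberg F i j k p = 0) (hρ : ContDiffOn ℝ ∞ ρ U)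
    (hρ0 : ∀ u ∈ U, 0 < ρ u) (hp : p ∈ slit U) :
    ricInfScalar F ρ p = ∑ j, p.2 j * ricCovector F ρ j p := by
  have hS := differentiableAt_of_slit hF.isOpen (hF.smooth_horizS hρ hρ0) hp
  have hS' : sCurv F ρ =ᶠ[nhds p] horizS F ρ :=
    Filter.eventuallyEq_of_mem ((isOpen_slit hF.isOpen).mem_nhds hp)
      fun q hq => hF.sCurv_eq hρ hρ0 hq
  have h1 : ricci F p =
      ∑ j, p.2 j * ∑ k, (hd F k (nonlin F k j) p - hd F j (nonlin F k k) p) := by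
    simp only [← hF.sum_mul_chernRiem hL hp, Finset.mul_sum, ricci]
    rw [Finset.sum_comm_cycle]
    refine Finset.sum_congr rfl fun l _ => ?_
    rw [Finset.sum_comm]
    exact Finset.sum_congr rfl fun k _ => Finset.sum_congr rfl fun i _ => by ring
  rw [ricInfScalar, h1, hF.geodesicDeriv_eq hp (hS.congr_of_eventuallyEq hS')]
  simp only [hd_eq_fderiv F (sCurv F ρ), hS'.fderiv_eq]
  simp only [← hd_eq_fderiv, ricCovector, mul_add, Finset.sum_add_distrib]

end IsLocalMetric

/-! ### Differentiation of the soliton equations along a fibre -/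

/-- Vertical derivatives depend only on the restriction to the fibre. -/
theorem pdy_congr_fibre (hf : DifferentiableAt ℝ f p) (hh : DifferentiableAt ℝ h p)
    (hp : p.2 ≠ 0) (hfh : ∀ z ≠ 0, f (p.1, z) = h (p.1, z)) (l : Fin n) :
    pdy l f p = pdy l h p := by
  let ι : E n → E n × E n := fun z => (p.1, z)
  have hι : HasFDerivAt ι (ContinuousLinearMap.inr ℝ (E n) (E n)) p.2 :=
    hasFDerivAt_prodMk_right _ _
  have h1 : HasFDerivAt (fun z => f (ι z)) _ p.2 := HasFDerivAt.comp (g := f) p.2 hf.hasFDerivAt hι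
  have h2 : HasFDerivAt (fun z => h (ι z)) _ p.2 := HasFDerivAt.comp (g := h) p.2 hh.hasFDerivAt hι
  have h3 : (fun z => f (ι z)) =ᶠ[nhds p.2] fun z => h (ι z) :=
    Filter.eventuallyEq_of_mem (isOpen_compl_singleton.mem_nhds hp) fun z hz => hfh z hz
  have h4 := congrArg (fun L => L (EuclideanSpace.single l 1))
    ((h1.congr_of_eventuallyEq h3.symm).unique h2)
  simpa [pdy] using h4

namespace IsLocalMetric

/-- Vertical differentiation of the asymmetric equation on one fibre, where `σ` has the value `c`,
yields the essential equation. -/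
theorem wRic_eq_of_contraction (hF : IsLocalMetric F U)
    (hL : ∀ p ∈ slit U, ∀ i j k, landsberg F i j k p = 0) (hρ : ContDiffOn ℝ ∞ ρ U)
    (hρ0 : ∀ u ∈ U, 0 < ρ u) (hp : p ∈ slit U) {c : ℝ} {j : Fin n}
    (hA : ∀ z ≠ 0, ∑ i, z i * wRic F ρ i j (p.1, z) = c * ∑ i, z i * g F i j (p.1, z))
    (l : Fin n) : wRic F ρ l j p = c * g F l j p := by
  have hm : ∀ z ≠ 0, (p.1, z) ∈ slit U := fun z hz => mem_slit.2 ⟨(mem_slit.1 hp).1, hz⟩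
  have hd := differentiableAt_of_slit hF.isOpen (hF.smooth_pdy_sq j) hp
  have h1 := pdy_congr_fibre (f := ricCovector F ρ j)
    (h := fun q => c * ((1 / 2) * pdy j (fun q => F q ^ 2) q))
    (differentiableAt_of_slit hF.isOpen (hF.smooth_ricCovector hρ hρ0 j) hp)
    ((hd.const_mul _).const_mul _) (mem_slit.1 hp).2
    (fun z hz => by
      rw [← hF.sum_mul_wRic hL hρ hρ0 (hm z hz), ← hF.sum_g_mul (hm z hz)]
      exact hA z hz) l
  rw [hF.pdy_ricCovector hL hρ hρ0 hp, pdy, fderiv_const_mul (hd.const_mul _),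
    fderiv_const_mul hd] at h1
  exact h1

/-- Vertical differentiation of the gradient equation on one fibre, where `σ` has the value `c`,
yields the symmetric equation. -/
theorem symmetrized_wRic_eq_of_scalar (hF : IsLocalMetric F U)
    (hL : ∀ p ∈ slit U, ∀ i j k, landsberg F i j k p = 0) (hρ : ContDiffOn ℝ ∞ ρ U)
    (hρ0 : ∀ u ∈ U, 0 < ρ u) (hp : p ∈ slit U) {c : ℝ}
    (hG : ∀ z ≠ 0, ricInfScalar F ρ (p.1, z) = c * F (p.1, z) ^ 2) (l : Fin n) :
    (1 / 2) * (∑ i, p.2 i * wRic F ρ i l p + ∑ j, wRic F ρ l j p * p.2 j) =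
      c * ∑ i, p.2 i * g F i l p := by
  have hm : ∀ z ≠ 0, (p.1, z) ∈ slit U := fun z hz => mem_slit.2 ⟨(mem_slit.1 hp).1, hz⟩
  have hd := differentiableAt_of_slit hF.isOpen hF.smooth_sq hp
  have hd2 := fun j => differentiableAt_of_slit hF.isOpen (hF.smooth_ricCovector hρ hρ0 j) hp
  have h1 := pdy_congr_fibre (f := fun q => ∑ j, q.2 j * ricCovector F ρ j q)
    (h := fun q => c * F q ^ 2)
    (differentiableAt_of_slit hF.isOpen (ContDiffOn.sum fun j _ =>
      (contDiffOn_snd_apply j _).mul (hF.smooth_ricCovector hρ hρ0 j)) hp)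
    (hd.const_mul _) (mem_slit.1 hp).2
    (fun z hz => by rw [← hG z hz, hF.ricInfScalar_eq hL hρ hρ0 (hm z hz)]) l
  rw [pdy, pdy, fderiv_sum_snd_mul hd2, fderiv_const_mul hd, Finset.sum_add_distrib] at h1
  have h2 : ∀ j, fderiv ℝ (ricCovector F ρ j) p (0, EuclideanSpace.single l 1) =
      wRic F ρ l j p := fun j => hF.pdy_ricCovector hL hρ hρ0 hp l j
  simp only [h2] at h1
  rw [hF.sum_mul_wRic hL hρ hρ0 hp, hF.sum_g_mul hp]
  simp only [PiLp.single_apply, ite_mul, one_mul, zero_mul, Finset.sum_ite_eq', Finset.mem_univ,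
    if_true, smul_apply, smul_eq_mul] at h1
  simp only [mul_comm _ (p.2 _)]
  rw [h1, pdy]
  ring

theorem ricInfScalar_eq_sum (hF : IsLocalMetric F U)
    (hL : ∀ p ∈ slit U, ∀ i j k, landsberg F i j k p = 0) (hρ : ContDiffOn ℝ ∞ ρ U)
    (hρ0 : ∀ u ∈ U, 0 < ρ u) (hp : p ∈ slit U) :
    ricInfScalar F ρ p = ∑ i, ∑ j, wRic F ρ i j p * p.2 i * p.2 j := by
  rw [hF.ricInfScalar_eq hL hρ hρ0 hp, Finset.sum_comm]
  refine Finset.sum_congr rfl fun j _ => ?_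
  rw [← hF.sum_mul_wRic hL hρ hρ0 hp, Finset.mul_sum]
  exact Finset.sum_congr rfl fun i _ => by ring

theorem sq_eq_sum (hF : IsLocalMetric F U) (hp : p ∈ slit U) :
    F p ^ 2 = ∑ i, ∑ j, g F i j p * p.2 i * p.2 j := by
  have h := hF.homog_sq.euler hF.isOpen hF.smooth_sq hp
  simp only [Nat.cast_ofNat] at h
  rw [Finset.sum_comm]
  have : ∀ j, ∑ i, g F i j p * p.2 i * p.2 j =
      (1 / 2) * (p.2 j * pdy j (fun q => F q ^ 2) p) := by
    intro j
    rw [← Finset.sum_mul]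
    simp only [mul_comm (g F _ j p), hF.sum_g_mul hp]
    ring
  simp only [this, ← Finset.mul_sum, h]
  ring

end IsLocalMetric

end CoordinatePatch

/-! ### Chart expressions on a manifold -/

section Charts

variable {n : ℕ} {M : Type*} [TopologicalSpace M] [ChartedSpace (E n) M]
  {φ : OpenPartialHomeomorph M (E n)}

theorem mdifferentiable_of_mem_smoothCharts (hφ : φ ∈ smoothCharts n M) :
    φ.MDifferentiable (𝓡 n) (𝓡 n) :=
  ⟨(contMDiffOn_of_mem_maximalAtlas hφ).mdifferentiableOn (by simp),
    (contMDiffOn_symm_of_mem_maximalAtlas hφ).mdifferentiableOn (by simp)⟩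

theorem mfderiv_symm_comps (hφ : φ ∈ smoothCharts n M) {x : M} (hx : x ∈ φ.source)
    (y : TangentSpace (𝓡 n) x) :
    (⟨φ.symm (φ x), mfderiv (𝓡 n) (𝓡 n) φ.symm (φ x) (comps φ x y)⟩ : TangentBundle (𝓡 n) M) =
      ⟨x, y⟩ := by
  have h := congrArg (fun L => L y) ((mdifferentiable_of_mem_smoothCharts hφ).symm_comp_deriv hx)
  have h' : mfderiv (𝓡 n) (𝓡 n) φ.symm (φ x) (comps φ x y) = y := h
  exact congrArg₂ (fun a (b : E n) => (⟨a, b⟩ : TangentBundle (𝓡 n) M)) (φ.left_inv hx) h'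

theorem localExpr_comps (hφ : φ ∈ smoothCharts n M) {x : M} (hx : x ∈ φ.source)
    (y : TangentSpace (𝓡 n) x) (f : TangentBundle (𝓡 n) M → ℝ) :
    localExpr φ f (φ x, comps φ x y) = f ⟨x, y⟩ :=
  congrArg f (mfderiv_symm_comps hφ hx y)

theorem comps_bijective (hφ : φ ∈ smoothCharts n M) {x : M} (hx : x ∈ φ.source) :
    Function.Bijective (comps φ x) :=
  (mdifferentiable_of_mem_smoothCharts hφ).mfderiv_bijective hx

theorem comps_ne_zero (hφ : φ ∈ smoothCharts n M) {x : M} (hx : x ∈ φ.source)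
    {y : TangentSpace (𝓡 n) x} : comps φ x y ≠ 0 ↔ y ≠ 0 := by
  have h0 : comps φ x 0 = 0 := map_zero (mfderiv (𝓡 n) (𝓡 n) φ x)
  rw [← h0]
  exact (comps_bijective hφ hx).1.ne_iff

theorem comps_mem_slit (hφ : φ ∈ smoothCharts n M) {x : M} (hx : x ∈ φ.source)
    {y : TangentSpace (𝓡 n) x} (hy : y ≠ 0) : (φ x, comps φ x y) ∈ slit φ.target :=
  mem_slit.2 ⟨φ.map_source hx, (comps_ne_zero hφ hx).2 hy⟩

/-- Every point of the slit bundle over the chart domain comes from a nonzero tangent vector. -/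
theorem exists_comps_eq (hφ : φ ∈ smoothCharts n M) {p : E n × E n} (hp : p ∈ slit φ.target) :
    ∃ x ∈ φ.source, ∃ y : TangentSpace (𝓡 n) x, y ≠ 0 ∧ (φ x, comps φ x y) = p := by
  obtain ⟨h1, h2⟩ := mem_slit.1 hp
  have hx := φ.map_target h1
  obtain ⟨y, hy⟩ := (comps_bijective hφ hx).2 p.2
  refine ⟨φ.symm p.1, hx, y, ?_, Prod.ext (φ.right_inv h1) hy⟩
  rw [← comps_ne_zero hφ hx, hy]
  exact h2

variable [IsManifold (𝓡 n) ∞ M]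

theorem contDiffOn_localExpr (hφ : φ ∈ smoothCharts n M) {f : TangentBundle (𝓡 n) M → ℝ}
    (hf : ContMDiffOn (𝓡 n).tangent 𝓘(ℝ, ℝ) ∞ f {v | v.2 ≠ 0}) :
    ContDiffOn ℝ ∞ (localExpr φ f) (slit φ.target) := by
  have hT := (contMDiffOn_symm_of_mem_maximalAtlas hφ).contMDiffOn_tangentMapWithin (m := ∞)
    (by simp) φ.open_target.uniqueMDiffOn
  have hι : ContMDiff 𝓘(ℝ, E n × E n) (𝓡 n).tangent ∞
      (fun q : E n × E n => (⟨q.1, q.2⟩ : TangentBundle (𝓡 n) (E n))) := by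
    intro q
    refine Bundle.contMDiffAt_totalSpace.2 ⟨contDiff_fst.contMDiff.contMDiffAt, ?_⟩
    convert! (contDiff_snd (𝕜 := ℝ) (E := E n) (F := E n)).contMDiff.contMDiffAt with z
    simp
    rfl
  have hval : ∀ q ∈ slit φ.target, tangentMapWithin (𝓡 n) (𝓡 n) φ.symm φ.target ⟨q.1, q.2⟩ =
      ⟨φ.symm q.1, mfderiv (𝓡 n) (𝓡 n) φ.symm q.1 q.2⟩ := fun q hq => by
    rw [tangentMapWithin, mfderivWithin_of_isOpen φ.open_target (mem_slit.1 hq).1]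
  have h1 := hT.comp hι.contMDiffOn (s := slit φ.target) fun q hq => (mem_slit.1 hq).1
  have h2 := hf.comp h1 (fun q hq => by
    change (tangentMapWithin (𝓡 n) (𝓡 n) φ.symm φ.target ⟨q.1, q.2⟩).2 ≠ 0
    rw [hval q hq]
    obtain ⟨x, hx, y, hy, rfl⟩ := exists_comps_eq hφ hq
    rw [mfderiv_symm_comps hφ hx]
    exact hy)
  exact (contMDiffOn_iff_contDiffOn.1 h2).congr fun q hq => (congrArg f (hval q hq)).symm

theorem Metric.isLocalMetric (F : Metric n M) (hφ : φ ∈ smoothCharts n M) :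
    IsLocalMetric (localExpr φ F.toFun) φ.target where
  isOpen := φ.open_target
  smooth := contDiffOn_localExpr hφ F.smooth
  homog p hp t ht := by
    have h : mfderiv (𝓡 n) (𝓡 n) φ.symm p.1 (t • p.2) =
        t • mfderiv (𝓡 n) (𝓡 n) φ.symm p.1 p.2 :=
      ContinuousLinearMap.map_smul (mfderiv (𝓡 n) (𝓡 n) φ.symm p.1) t p.2
    simp only [localExpr, h, pow_one]
    exact F.homog _ _ t ht
  posDef p hp := by
    obtain ⟨x, hx, y, hy, rfl⟩ := exists_comps_eq hφ hp
    exact F.strongConvex φ hφ x hx y hy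

theorem IsLandsberg.landsberg_eq_zero {F : Metric n M} (hF : IsLandsberg F)
    (hφ : φ ∈ smoothCharts n M) :
    ∀ p ∈ slit φ.target, ∀ i j k, landsberg (localExpr φ F.toFun) i j k p = 0 := by
  intro p hp
  obtain ⟨x, hx, y, hy, rfl⟩ := exists_comps_eq hφ hp
  exact hF φ hφ x hx y hy

variable [MeasurableSpace M] {F : Metric n M} {μ : SmoothMeasure n M} {σ : M → ℝ}

/-! ### Equivalence of the soliton equations -/

theorem asymmetricEssentialEq_iff (hF : IsLandsberg F) :
    AsymmetricEssentialEq F μ σ ↔ AsymmetricEq F μ σ := by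
  refine ⟨fun h φ hφ x hx y hy V => h φ hφ x hx y hy y V, fun h φ hφ x hx y hy V W => ?_⟩
  have key := fun l j => (F.isLocalMetric hφ).wRic_eq_of_contraction (hF.landsberg_eq_zero hφ)
    (μ.density_smooth φ hφ) (μ.density_pos φ hφ) (comps_mem_slit hφ hx hy) (c := σ x) (j := j)
    (fun z hz => by
      obtain ⟨y', rfl⟩ := (comps_bijective hφ hx).2 z
      obtain ⟨V', hV'⟩ := (comps_bijective hφ hx).2 (EuclideanSpace.single j 1)
      have := h φ hφ x hx y' ((comps_ne_zero hφ hx).1 hz) V'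
      simp only [ricInfForm, gForm, hV', PiLp.single_apply, mul_ite, mul_one, mul_zero,
        Finset.sum_ite_eq', Finset.mem_univ, if_true] at this
      simpa only [mul_comm] using this) l
  simp only [ricInfForm, gForm, key, Finset.mul_sum, mul_assoc]

theorem gradientEq_iff (hF : IsLandsberg F) :
    GradientEq F μ σ ↔ SymmetricEq F μ σ := by
  constructor
  · intro h φ hφ x hx y hy V
    have key := fun l => (F.isLocalMetric hφ).symmetrized_wRic_eq_of_scalar
      (hF.landsberg_eq_zero hφ) (μ.density_smooth φ hφ) (μ.density_pos φ hφ) (comps_mem_slit hφ hx hy) (c := σ x)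
      (fun z hz => by
        obtain ⟨y', rfl⟩ := (comps_bijective hφ hx).2 z
        have := h φ hφ x hx y' ((comps_ne_zero hφ hx).1 hz)
        rw [localExpr_comps hφ hx]
        exact this) l
    have hg : gForm F φ x y y V = ∑ l, (∑ i, comps φ x y i *
        g (localExpr φ F.toFun) i l (φ x, comps φ x y)) * comps φ x V l := by
      simp only [gForm, Finset.sum_mul]
      rw [Finset.sum_comm]
      exact Finset.sum_congr rfl fun l _ => Finset.sum_congr rfl fun i _ => by ring
    have hr1 : ricInfForm F μ φ x y y V = ∑ l, (∑ i, comps φ x y i *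
        wRic (localExpr φ F.toFun) (μ.density φ) i l (φ x, comps φ x y)) * comps φ x V l := by
      simp only [ricInfForm, Finset.sum_mul]
      rw [Finset.sum_comm]
      exact Finset.sum_congr rfl fun l _ => Finset.sum_congr rfl fun i _ => by ring
    have hr2 : ricInfForm F μ φ x y V y = ∑ l, (∑ j,
        wRic (localExpr φ F.toFun) (μ.density φ) l j (φ x, comps φ x y) * comps φ x y j) *
          comps φ x V l := by
      simp only [ricInfForm, Finset.sum_mul]
      exact Finset.sum_congr rfl fun l _ => Finset.sum_congr rfl fun i _ => by ring
    rw [hg, hr1, hr2, ← Finset.sum_add_distrib, Finset.mul_sum, Finset.mul_sum]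
    refine Finset.sum_congr rfl fun l _ => ?_
    rw [← mul_assoc, ← key l]
    ring
  · intro h φ hφ x hx y hy
    have hm := comps_mem_slit hφ hx hy
    have h1 := h φ hφ x hx y hy y
    have h2 : ricInf F μ φ x y = ricInfForm F μ φ x y y y :=
      (F.isLocalMetric hφ).ricInfScalar_eq_sum (hF.landsberg_eq_zero hφ)
        (μ.density_smooth φ hφ) (μ.density_pos φ hφ) hm
    have h3 : F.toFun ⟨x, y⟩ ^ 2 = gForm F φ x y y y := by
      rw [← localExpr_comps hφ hx y F.toFun]
      exact (F.isLocalMetric hφ).sq_eq_sum hm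
    rw [h2, h3, ← h1]
    ring

end Charts

end Finsler

end

theorem mainTheorem9 {n : ℕ} {M : Type*} [TopologicalSpace M] [T2Space M]
    [SecondCountableTopology M] [ChartedSpace (EuclideanSpace ℝ (Fin n)) M]
    [IsManifold (𝓡 n) ∞ M] [MeasurableSpace M] [BorelSpace M]
    (F : Finsler.Metric n M) (μ : Finsler.SmoothMeasure n M) (hF : Finsler.IsLandsberg F) :
    ((Finsler.IsAsymmetricEssentialGradientAlmostRicciSoliton F μ ↔
        Finsler.IsAsymmetricGradientAlmostRicciSoliton F μ) ∧
      (Finsler.IsGradientAlmostRicciSoliton F μ ↔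
        Finsler.IsSymmetricGradientAlmostRicciSoliton F μ)) ∧
    ∀ σ : M → ℝ,
      (Finsler.AsymmetricEssentialEq F μ σ ↔ Finsler.AsymmetricEq F μ σ) ∧
      (Finsler.GradientEq F μ σ ↔ Finsler.SymmetricEq F μ σ) :=
  ⟨⟨exists_congr fun _ => Finsler.asymmetricEssentialEq_iff hF,
    exists_congr fun _ => Finsler.gradientEq_iff hF⟩,
    fun _ => ⟨Finsler.asymmetricEssentialEq_iff hF, Finsler.gradientEq_iff hF⟩⟩
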